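/- **Setting.** Let $X\neq\emptyset$, let $k:X\times X\to\mathbb R$ be a kernel with reproducing kernel Hilbert space $H_k$, and let $d_k(x,x')=\|k(\cdot,x)-k(\cdot,x')\|_k$. Assume that the (semi)metric space $(X,d_k)$ is compact and that $k$ is bounded, Borel measurable and characteristic, i.e. the kernel mean embedding $\Pi_k(\mu)=\int k(\cdot,x)\,d\mu(x)\in H_k$ is injective on the set $\mathcal P(X)$ of Borel probability measures. Put $\gamma_k(\mu,\nu)=\|\Pi_k(\mu)-\Pi_k(\nu)\|_k$ (the MMD), and for $\vec x\in X^M$, $M\ge 1$, let $\hat\mu[\vec x]=\frac1M\sum_{i=1}^M\delta_{x_i}$. Let $H$ be a real Hilbert space and $U\subseteq H$ compact and convex. For every $M\ge1$ let $f_M:X^M\times U\to X^M$ and $\ell_M:X^M\times U\to\mathbb R$ be such that, for constants $L_f,L_\ell\ge0$ independent of $M$, for all permutations $\sigma$ of $\{1,\dots,M\}$ and all $\vec x,\vec x'\in X^M$, $u,u'\in U$: - $f_M(\sigma\vec x,u)=\sigma f_M(\vec x,u)$ and $\gamma_k(\hat\mu[f_M(\vec x,u)],\hat\mu[f_M(\vec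 x',u')])\le L_f\,\|(\Pi_k(\hat\mu[\vec x]),u)-(\Pi_k(\hat\mu[\vec x']),u')\|_{H_k\times H}$ (Hilbert product norm); - $\ell_M(\sigma\vec x,u)=\ell_M(\vec x,u)$, the $\ell_M$ are bounded uniformly in $M$, and $|\ell_M(\vec x,u)-\ell_M(\vec x',u')|\le L_\ell(\gamma_k(\hat\mu[\vec x],\hat\mu[\vec x'])+\|u-u'\|_H)$. For a strictly increasing sequence $(N_p)_p$ of positive integers, we say that $f:\mathcal P(X)\times U\to\mathcal P(X)$ and $\ell:\mathcal P(X)\times U\to\mathbb R$ are the *mean field limits of $(f_M)$ and $(\ell_M)$ along $(N_p)$* if they are $L_f$-, respectively $L_\ell$-Lipschitz, i.e. $\gamma_k(f(\mu,u),f(\nu,u'))\le L_f\|(\Pi_k(\mu),u)-(\Pi_k(\nu),u')\|_{H_k\times H}$ and $|\ell(\mu,u)-\ell(\nu,u')|\le L_\ell(\gamma_k(\mu,\nu)+\|u-u'\|_H)$, and, as $p\to\infty$, $$\sup_{\vec x\in X^{N_p},u\in U}\gamma_k(\hat\mu[f_{N_p}(\vec x,u)],f(\hat\mu[\vec x],u))\to0,\qquad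 \sup_{\vec x\in X^{N_p},u\in U}|\ell_{N_p}(\vec x,u)-\ell(\hat\mu[\vec x],u)|\to0 .$$ **Theorem 3.** Such a sequence $(N_p)$ and such mean field limits $f,\ell$ exist. Moreover, let $(N_p)$, $f$, $\ell$ be any such sequence and limits. For every $M$ in $\{N_p\}$ let $\tilde V_M:X^M\to\mathbb R_{\ge0}$ and $\kappa_M:X^M\to U$ be permutation invariant with $$|\tilde V_M(\vec x)-\tilde V_M(\vec x')|\le L_{\tilde V}\,\gamma_k(\hat\mu[\vec x],\hat\mu[\vec x']),\qquad \|\kappa_M(\vec x)-\kappa_M(\vec x')\|_H\le L_\kappa\,\gamma_k(\hat\mu[\vec x],\hat\mu[\vec x'])$$ for all $\vec x,\vec x'\in X^M$, with constants $L_{\tilde V},L_\kappa\ge0$ independent of $M$, and suppose that for some $\alpha\in(0,1]$, all $M\in\{N_p\}$ and all $\vec x\in X^M$ $$\tilde V_M(\vec x)\ \ge\ \tilde V_M\big(f_M(\vec x,\kappa_M(\vec x))\big)+\alpha\,\ell_M(\vec x,\kappa_M(\vec x)).$$ Then there exist a subsequence $(M_m)_m$ of $(N_p)_p$, a function $\tilde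 V:\mathcal P(X)\to\mathbb R_{\ge0}$ that is $L_{\tilde V}$-Lipschitz with respect to $\gamma_k$, and a map $\kappa:\mathcal P(X)\to U$ that is $L_\kappa$-Lipschitz with respect to $\gamma_k$, such that $\sup_{\vec x\in X^{M_m}}\|\kappa_{M_m}(\vec x)-\kappa(\hat\mu[\vec x])\|_H\to0$ and, for all $\mu\in\mathcal P(X)$, $$\tilde V(\mu)\ \ge\ \tilde V\big(f(\mu,\kappa(\mu))\big)+\alpha\,\ell(\mu,\kappa(\mu)).$$ If in addition the $\tilde V_M$, $M\in\{N_p\}$, are bounded uniformly in $M$, then $\tilde V$ can be chosen (with the same subsequence and the same $\kappa$) such that also $\sup_{\vec x\in X^{M_m}}|\tilde V_{M_m}(\vec x)-\tilde V(\hat\mu[\vec x])|\to0$. -/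

import Mathlib

open MeasureTheory Filter
open scoped NNReal ENNReal Topology InnerProductSpace

noncomputable section

namespace MeanField

section Kernel

variable {X : Type*} (Hk : Type*) [NormedAddCommGroup Hk] [InnerProductSpace ℝ Hk]
  [CompleteSpace Hk] [RKHS ℝ Hk X ℝ]

/-- The element `k(·, x)` of the reproducing kernel Hilbert space `Hk`, i.e. the representer of
point evaluation at `x`. -/
def feature (x : X) : Hk := RKHS.kerFun Hk x (1 : ℝ)

/-- The reproducing property of `feature`. -/
theorem inner_feature (g : Hk) (x : X) : ⟪g, feature Hk x⟫_ℝ = g x := by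
  simp [feature]

/-- `k` is the reproducing kernel of `Hk`; then `Hk` is, up to isometry, the unique reproducing
kernel Hilbert space `H_k` of the kernel `k`. -/
def IsReproducingKernel (k : X → X → ℝ) : Prop :=
  ∀ x y : X, (feature Hk y : Hk) x = k x y

/-- The kernel (semi)metric `d_k(x, x') = ‖k(·, x) - k(·, x')‖_k`. -/
def kernelDist (x x' : X) : ℝ := ‖feature Hk x - feature Hk x'‖

/-- The kernel mean embedding `Π_k(μ) = ∫ k(·, x) dμ(x)`, a Bochner integral in `Hk`. -/
def kme [MeasurableSpace X] (μ : ProbabilityMeasure X) : Hk :=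
  ∫ x, feature Hk x ∂(μ : Measure X)

/-- The maximum mean discrepancy `γ_k(μ, ν) = ‖Π_k(μ) - Π_k(ν)‖_k`. -/
def mmd [MeasurableSpace X] (μ ν : ProbabilityMeasure X) : ℝ :=
  ‖kme Hk μ - kme Hk ν‖

/-- Standing assumption on the space and the kernel: `k` is the kernel of `Hk`, the (semi)metric of
`X` is the kernel (semi)metric, `(X, d_k)` is compact, and `k` is bounded, Borel measurable and
characteristic. -/
structure SpaceAssumption [PseudoMetricSpace X] [MeasurableSpace X] (k : X → X → ℝ) : Prop where
  reproducing : IsReproducingKernel Hk k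
  dist_eq : ∀ x x' : X, dist x x' = kernelDist Hk x x'
  compact : CompactSpace X
  bounded : ∃ C : ℝ, ∀ x x' : X, |k x x'| ≤ C
  measurable : Measurable (Function.uncurry k)
  characteristic : Function.Injective (kme Hk : ProbabilityMeasure X → Hk)

end Kernel

/-- The empirical measure `(1/M) ∑ δ_{x_i}` of a tuple `x ∈ X^M`, `M ≥ 1`. -/
def empirical {X : Type*} [MeasurableSpace X] {M : ℕ+}
    (x : Fin M → X) : ProbabilityMeasure X :=
  ⟨((M : ℕ) : ℝ≥0∞)⁻¹ • ∑ i, Measure.dirac (x i), ⟨by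
    have h0 : ((M : ℕ) : ℝ≥0∞) ≠ 0 := by exact_mod_cast M.ne_zero
    simp [ENNReal.inv_mul_cancel h0 (ENNReal.natCast_ne_top _)]⟩⟩

section Systems

variable {X : Type*} [PseudoMetricSpace X] [MeasurableSpace X]
  (Hk : Type*) [NormedAddCommGroup Hk] [InnerProductSpace ℝ Hk] [CompleteSpace Hk]
  [RKHS ℝ Hk X ℝ]
  {H : Type*} [NormedAddCommGroup H] [InnerProductSpace ℝ H] (U : Set H)

/-- The distance `‖(Π_k(μ), u) - (Π_k(ν), u')‖` in the product Hilbert space `H_k × H`. -/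
def prodDist (μ ν : ProbabilityMeasure X) (u u' : H) : ℝ :=
  ‖(WithLp.toLp 2 (kme Hk μ, u) : WithLp 2 (Hk × H)) - WithLp.toLp 2 (kme Hk ν, u')‖

/-- Assumption on the transition functions `f^{[M]} : X^M × U → X^M`: permutation equivariance in
the state, and Lipschitz continuity with a constant `Lf` that does not depend on `M`. -/
structure SystemAssumption (f : ∀ M : ℕ+, (Fin M → X) → U → (Fin M → X)) (Lf : ℝ) : Prop where
  equivariant : ∀ (M : ℕ+) (x : Fin M → X) (σ : Equiv.Perm (Fin M)) (u : U),
    f M (x ∘ σ) u = f M x u ∘ σ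
  lipschitz : ∀ (M : ℕ+) (x x' : Fin M → X) (u u' : U),
    mmd Hk (empirical (f M x u)) (empirical (f M x' u')) ≤
      Lf * prodDist Hk (empirical x) (empirical x') (u : H) (u' : H)

/-- Assumption on the stage costs `ℓ^{[M]} : X^M × U → ℝ`: permutation invariance in the state,
uniform boundedness, and Lipschitz continuity with a constant `Ll` that does not depend
on `M`. -/
structure CostAssumption (l : ∀ M : ℕ+, (Fin M → X) → U → ℝ) (Ll : ℝ) : Prop where
  invariant : ∀ (M : ℕ+) (x : Fin M → X) (σ : Equiv.Perm (Fin M)) (u : U),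
    l M (x ∘ σ) u = l M x u
  bounded : ∃ B : ℝ, ∀ (M : ℕ+) (x : Fin M → X) (u : U), |l M x u| ≤ B
  lipschitz : ∀ (M : ℕ+) (x x' : Fin M → X) (u u' : U),
    |l M x u - l M x' u'| ≤ Ll * (mmd Hk (empirical x) (empirical x') + ‖(u : H) - (u' : H)‖)

/-- `F : P(X) × U → P(X)` is the mean field limit of the transition functions along the index
sequence `N`: it is `Lf`-Lipschitz and
`sup_{x ∈ X^{N p}, u ∈ U} γ_k(μ̂[f^{[N p]}(x, u)], F(μ̂[x], u)) → 0` as `p → ∞`. -/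
structure IsLimitDynamics (f : ∀ M : ℕ+, (Fin M → X) → U → (Fin M → X)) (Lf : ℝ) (N : ℕ → ℕ+)
    (F : ProbabilityMeasure X → U → ProbabilityMeasure X) : Prop where
  lipschitz : ∀ (μ ν : ProbabilityMeasure X) (u u' : U),
    mmd Hk (F μ u) (F ν u') ≤ Lf * prodDist Hk μ ν (u : H) (u' : H)
  tendsto : ∀ ε > 0, ∀ᶠ p in atTop, ∀ (x : Fin (N p) → X) (u : U),
    mmd Hk (empirical (f (N p) x u)) (F (empirical x) u) ≤ ε

/-- `l∞ : P(X) × U → ℝ` is the mean field limit of the stage costs along the index sequence `N`: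
it is `Ll`-Lipschitz and `sup_{x ∈ X^{N p}, u ∈ U} |ℓ^{[N p]}(x, u) - l∞(μ̂[x], u)| → 0` as
`p → ∞`. -/
structure IsLimitCost (l : ∀ M : ℕ+, (Fin M → X) → U → ℝ) (Ll : ℝ) (N : ℕ → ℕ+)
    (linf : ProbabilityMeasure X → U → ℝ) : Prop where
  lipschitz : ∀ (μ ν : ProbabilityMeasure X) (u u' : U),
    |linf μ u - linf ν u'| ≤ Ll * (mmd Hk μ ν + ‖(u : H) - (u' : H)‖)
  tendsto : ∀ ε > 0, ∀ᶠ p in atTop, ∀ (x : Fin (N p) → X) (u : U),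
    |l (N p) x u - linf (empirical x) u| ≤ ε

end Systems

end MeanField

end

/-! The mean embeddings of all probability measures form a compact subset of $H_k$
(`isCompact_range_integral`), and empirical measures of $M$ points come within $O(1/\sqrt M)$ of
each of them, uniformly (`exists_empirical_norm_sub_le`). Functions on $X^M$ that are Lipschitz in
the MMD with a common constant are thus functions on ever denser subsets of one compact space, and
an Arzelà–Ascoli argument (`exists_uniform_limit`) extracts a uniform Lipschitz limit. State-control
pairs give the limits of dynamics and cost, states alone those of feedbacks and value functions.

The inequality survives by evaluating it at empirical measures tending to $\mu$
(`relaxed_dynamic_programming_limit`). Value functions may diverge with $M$, but their oscillation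
is bounded and the inequality involves only differences of their values, so constants may be
subtracted first (`exists_sub_const_mem_Icc`). -/

namespace MeanField

/-! ### Arzelà–Ascoli on asymptotically dense sets. -/

section Compactness

open Set

/-- The triangle inequality through two intermediate points. -/
theorem lipschitz_along_approximation {Z E F : Type*} [PseudoMetricSpace E] [PseudoMetricSpace F]
    {Φ : Z → E} {A : Type*} {e : A → Z} {g : A → F} {L : ℝ} (hL : 0 ≤ L)
    (hg : ∀ a a', dist (g a) (g a') ≤ L * dist (Φ (e a)) (Φ (e a')))
    {a a' : A} {z z' : Z} {δ δ' : ℝ} (ha : dist (Φ (e a)) (Φ z) ≤ δ)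
    (ha' : dist (Φ (e a')) (Φ z') ≤ δ') :
    dist (g a) (g a') ≤ L * (dist (Φ z) (Φ z') + (δ + δ')) := by
  refine (hg a a').trans (mul_le_mul_of_nonneg_left ?_ hL)
  have := dist_triangle4 (Φ (e a)) (Φ z) (Φ z') (Φ (e a'))
  rw [dist_comm (Φ z')] at this
  linarith

/-- An Arzelà–Ascoli theorem for functions `g p` on index sets `A p` which are asymptotically dense
in a totally bounded space, and which are equi-Lipschitz there. -/
theorem exists_uniform_limit {Z E F : Type*} [PseudoMetricSpace E] [MetricSpace F]
    {Φ : Z → E} (hΦ : TotallyBounded (range Φ)) {K : Set F} (hK : IsCompact K)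
    {A : ℕ → Type*} (e : ∀ p, A p → Z) {δ : ℕ → ℝ} (hδ : Tendsto δ atTop (𝓝 0))
    (hdense : ∀ p z, ∃ a, dist (Φ (e p a)) (Φ z) ≤ δ p)
    (g : ∀ p, A p → F) (hgK : ∀ p a, g p a ∈ K) {L : ℝ} (hL : 0 ≤ L)
    (hg : ∀ p a a', dist (g p a) (g p a') ≤ L * dist (Φ (e p a)) (Φ (e p a'))) :
    ∃ (m : ℕ → ℕ) (G : Z → F), StrictMono m ∧ (∀ z, G z ∈ K) ∧
      (∀ z z', dist (G z) (G z') ≤ L * dist (Φ z) (Φ z')) ∧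
      ∀ ε > 0, ∀ᶠ j in atTop, ∀ a : A (m j), dist (g (m j) a) (G (e (m j) a)) ≤ ε := by
  rcases isEmpty_or_nonempty Z with hZ | hZ
  · exact ⟨id, isEmptyElim, strictMono_id, isEmptyElim, isEmptyElim,
      fun ε _ ↦ Eventually.of_forall fun j a ↦ isEmptyElim (e _ a)⟩
  choose a ha using hdense
  set γ : ℕ → Z → F := fun p z ↦ g p (a p z) with hγ
  have hγL : ∀ p z z', dist (γ p z) (γ p z') ≤ L * (dist (Φ z) (Φ z') + (δ p + δ p)) :=
    fun p z z' ↦ lipschitz_along_approximation hL (hg p) (ha p z) (ha p z')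
  -- `Z` carries no topology, so density is measured through `Φ`.
  obtain ⟨d, hd⟩ : ∃ d : ℕ → Z, ∀ z, ∀ ε > 0, ∃ n, dist (Φ z) (Φ (d n)) < ε := by
    have : Nonempty (range Φ) := (range_nonempty Φ).to_subtype
    have : TopologicalSpace.SeparableSpace (range Φ) := hΦ.isSeparable.separableSpace
    choose d hd using fun n ↦ (TopologicalSpace.denseSeq (range Φ) n).2
    refine ⟨d, fun z ε hε ↦ ?_⟩
    obtain ⟨n, hn⟩ := Metric.denseRange_iff.1
      (TopologicalSpace.denseRange_denseSeq (range Φ)) ⟨Φ z, mem_range_self z⟩ ε hε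
    exact ⟨n, by rw [hd]; exact hn⟩
  -- Sequential compactness of $K^{\mathbb N}$ replaces the diagonal argument.
  obtain ⟨c, -, m, hm, hc⟩ := (isCompact_univ_pi fun _ : ℕ ↦ hK).tendsto_subseq
    (x := fun p n ↦ γ p (d n)) fun p n _ ↦ hgK p _
  have hcn : ∀ n, Tendsto (fun j ↦ γ (m j) (d n)) atTop (𝓝 (c n)) := fun n ↦ tendsto_pi_nhds.1 hc n
  have hδm : Tendsto (fun j ↦ δ (m j)) atTop (𝓝 0) := hδ.comp hm.tendsto_atTop
  have hsmall : ∀ ε > 0, ∀ᶠ j in atTop, L * (δ (m j) + δ (m j)) < ε := fun ε hε ↦ by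
    have : Tendsto (fun j ↦ L * (δ (m j) + δ (m j))) atTop (𝓝 (L * (0 + 0))) :=
      (hδm.add hδm).const_mul L
    exact this.eventually (gt_mem_nhds (by simpa using hε))
  have hlim : ∀ z, ∃ y ∈ K, Tendsto (fun j ↦ γ (m j) z) atTop (𝓝 y) := by
    intro z
    refine cauchySeq_tendsto_of_isComplete hK.isComplete (fun j ↦ hgK _ _) ?_
    rw [Metric.cauchySeq_iff']
    intro ε hε
    -- Dividing by `L + 1` instead of `L` covers `L = 0`.
    obtain ⟨n, hn⟩ := hd z (ε / 8 / (L + 1)) (by positivity)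
    have hLn : L * dist (Φ z) (Φ (d n)) ≤ ε / 8 := by
      have : (L + 1) * dist (Φ z) (Φ (d n)) ≤ ε / 8 := by
        rw [mul_comm, ← le_div_iff₀ (by positivity)]; exact hn.le
      nlinarith [dist_nonneg (x := Φ z) (y := Φ (d n))]
    have h1 := (Metric.tendsto_nhds.1 (hcn n) (ε / 8) (by positivity)).and
      (hsmall (ε / 8) (by positivity))
    obtain ⟨N, hN⟩ := eventually_atTop.1 h1
    have key : ∀ j ≥ N, dist (γ (m j) z) (c n) < 3 * (ε / 8) := fun j hj ↦ by
      have h2 := hγL (m j) z (d n)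
      have h3 := hN j hj
      have h4 := dist_triangle (γ (m j) z) (γ (m j) (d n)) (c n)
      rw [mul_add] at h2
      linarith [h3.1, h3.2]
    refine ⟨N, fun j hj ↦ ?_⟩
    have h5 := key j hj
    have h6 := key N le_rfl
    have h7 := dist_triangle_right (γ (m j) z) (γ (m N) z) (c n)
    linarith
  choose G hGK hG using hlim
  have hGL : ∀ z z', dist (G z) (G z') ≤ L * dist (Φ z) (Φ z') := fun z z' ↦ by
    have h1 : Tendsto (fun j ↦ L * (dist (Φ z) (Φ z') + (δ (m j) + δ (m j)))) atTop
        (𝓝 (L * (dist (Φ z) (Φ z') + (0 + 0)))) :=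
      ((hδm.add hδm).const_add _).const_mul L
    simpa using le_of_tendsto_of_tendsto' ((hG z).dist (hG z')) h1 fun j ↦ hγL (m j) z z'
  refine ⟨m, G, hm, hGK, hGL, fun ε hε ↦ ?_⟩
  -- Pointwise convergence on a finite net, together with the Lipschitz bounds, gives uniform
  -- convergence.
  obtain ⟨t, htr, htf, ht⟩ := Metric.finite_approx_of_totallyBounded hΦ (ε / 8 / (L + 1))
    (by positivity)
  have h1 : ∀ᶠ j in atTop, ∀ y ∈ t, ∃ z, Φ z = y ∧ dist (γ (m j) z) (G z) < ε / 8 := by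
    rw [htf.eventually_all]
    intro y hy
    obtain ⟨z, rfl⟩ := htr hy
    filter_upwards [Metric.tendsto_nhds.1 (hG z) (ε / 8) (by positivity)] with j hj
    exact ⟨z, rfl, hj⟩
  filter_upwards [h1, hsmall (ε / 8) (by positivity)] with j hj hj' b
  obtain ⟨y, hy, hby⟩ := mem_iUnion₂.1 (ht (mem_range_self (e (m j) b)))
  obtain ⟨z, rfl, hz⟩ := hj y hy
  have hLz : L * dist (Φ (e (m j) b)) (Φ z) ≤ ε / 8 := by
    have : (L + 1) * dist (Φ (e (m j) b)) (Φ z) ≤ ε / 8 := by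
      rw [mul_comm, ← le_div_iff₀ (by positivity)]; exact (Metric.mem_ball.1 hby).le
    nlinarith [dist_nonneg (x := Φ (e (m j) b)) (y := Φ z)]
  have hδ0 : 0 ≤ δ (m j) := dist_nonneg.trans (ha (m j) z)
  -- The point `b` approximates its own image with error zero, which is at most `δ (m j)`.
  have h2 : dist (g (m j) b) (γ (m j) z) ≤
      L * (dist (Φ (e (m j) b)) (Φ z) + (δ (m j) + δ (m j))) :=
    lipschitz_along_approximation hL (hg (m j)) (by simpa using hδ0) (ha (m j) z)
  have h3 := hGL z (e (m j) b)
  rw [dist_comm (Φ z)] at h3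
  have h4 := dist_triangle4 (g (m j) b) (γ (m j) z) (G z) (G (e (m j) b))
  rw [mul_add] at h2
  linarith

end Compactness

/-! ### Barycenters: compactness and approximation by finite averages. -/

section Barycenter

open Set

/-- A continuous function on a compact pseudometrizable space is integrable with respect to every
finite measure. -/
theorem integrable_of_continuous_of_compactSpace {X E : Type*} [NormedAddCommGroup E]
    [TopologicalSpace X] [TopologicalSpace.PseudoMetrizableSpace X] [CompactSpace X] [MeasurableSpace X]
    [OpensMeasurableSpace X] {φ : X → E} (hφ : Continuous φ) (μ : Measure X) [IsFiniteMeasure μ] :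
    Integrable φ μ := by
  let := TopologicalSpace.pseudoMetrizableSpacePseudoMetric X
  obtain ⟨C, hC⟩ := (isCompact_range hφ).isBounded.exists_norm_le
  have : AEStronglyMeasurable φ μ := hφ.aestronglyMeasurable
  exact Integrable.of_bound this C (ae_of_all _ fun x ↦ hC _ (mem_range_self x))

variable {X E : Type*} [NormedAddCommGroup E] [InnerProductSpace ℝ E] [CompleteSpace E]

/-- The barycenters of the probability measures on a compact metrizable space form a compact
set. -/
theorem isCompact_range_integral_of_t2Space [TopologicalSpace X]
    [TopologicalSpace.PseudoMetrizableSpace X] [T2Space X] [CompactSpace X] [MeasurableSpace X]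
    [BorelSpace X] {φ : X → E} (hφ : Continuous φ) :
    IsCompact (range fun μ : ProbabilityMeasure X ↦ ∫ x, φ x ∂(μ : Measure X)) := by
  have hint := fun μ : ProbabilityMeasure X ↦
    integrable_of_continuous_of_compactSpace hφ (μ : Measure X)
  refine TotallyBounded.isCompact_of_isClosed ?_ ?_
  -- Barycenters lie in the closed convex hull of the compact set $\varphi(X)$.
  · refine (isCompact_range hφ).totallyBounded.convexHull.closure.subset ?_
    rintro _ ⟨μ, rfl⟩
    exact (convex_convexHull ℝ _).closure.integral_mem isClosed_closure
      (ae_of_all _ fun x ↦ subset_closure (subset_convexHull ℝ _ (mem_range_self x))) (hint μ)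
  -- Weak compactness of the probability measures yields a limit along an ultrafilter. Weak
  -- convergence tests only scalar functions, so barycenters are compared through inner products.
  · refine isClosed_of_closure_subset fun h hh ↦ ?_
    obtain ⟨u, hu, hlim⟩ := mem_closure_iff_seq_limit.1 hh
    choose ν hν using hu
    set v : Ultrafilter (ProbabilityMeasure X) := (hyperfilter ℕ).map ν with hv
    have hvl : Tendsto ν (hyperfilter ℕ) (𝓝 v.lim) := v.le_nhds_lim
    refine ⟨v.lim, ext_inner_left ℝ fun w ↦ ?_⟩
    have hinner : ∀ μ : ProbabilityMeasure X,
        ⟪w, ∫ x, φ x ∂(μ : Measure X)⟫_ℝ = ∫ x, ⟪w, φ x⟫_ℝ ∂(μ : Measure X) :=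
      fun μ ↦ (integral_inner (hint μ) w).symm
    have h1 := ProbabilityMeasure.tendsto_iff_forall_integral_tendsto.1 hvl
      (BoundedContinuousFunction.mkOfCompact ⟨fun x ↦ ⟪w, φ x⟫_ℝ, by fun_prop⟩)
    have h2 : Tendsto (fun n ↦ ⟪w, u n⟫_ℝ) (hyperfilter ℕ) (𝓝 ⟪w, h⟫_ℝ) :=
      ((tendsto_const_nhds.inner hlim).mono_left Nat.hyperfilter_le_atTop)
    refine tendsto_nhds_unique ?_ h2
    simp only [← hν, hinner]
    exact h1

/-- The barycenters of the probability measures on a compact pseudometric space form a compact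
set. -/
theorem isCompact_range_integral [PseudoMetricSpace X] [CompactSpace X] [MeasurableSpace X]
    [BorelSpace X] {φ : X → E} (hφ : Continuous φ) :
    IsCompact (range fun μ : ProbabilityMeasure X ↦ ∫ x, φ x ∂(μ : Measure X)) := by
  -- Any section `s` of the Hausdorff quotient is continuous, and `φ` is constant on classes, so
  -- pushforwards both ways preserve barycenters.
  let : MeasurableSpace (SeparationQuotient X) := borel _
  have : BorelSpace (SeparationQuotient X) := ⟨rfl⟩
  have hmk : Continuous (SeparationQuotient.mk : X → SeparationQuotient X) :=
    SeparationQuotient.continuous_mk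
  have : CompactSpace (SeparationQuotient X) := Quotient.compactSpace
  obtain ⟨s, hs⟩ := (SeparationQuotient.surjective_mk (X := X)).hasRightInverse
  have hsc : Continuous s := by
    rw [SeparationQuotient.isInducing_mk.continuous_iff]
    exact continuous_id.congr fun q ↦ (hs q).symm
  have hφs : ∀ x, φ (s (SeparationQuotient.mk x)) = φ x := fun x ↦
    ((SeparationQuotient.mk_eq_mk.1 (hs (SeparationQuotient.mk x))).map hφ).eq
  convert isCompact_range_integral_of_t2Space (hφ.comp hsc) using 1
  apply Subset.antisymm
  · rintro _ ⟨μ, rfl⟩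
    refine ⟨μ.map hmk.aemeasurable, ?_⟩
    simp only [ProbabilityMeasure.toMeasure_map]
    rw [integral_map hmk.aemeasurable
      (integrable_of_continuous_of_compactSpace (hφ.comp hsc) _).aestronglyMeasurable]
    simp [hφs]
  · rintro _ ⟨ν, rfl⟩
    refine ⟨ν.map hsc.aemeasurable, ?_⟩
    simp only [ProbabilityMeasure.toMeasure_map]
    rw [integral_map hsc.aemeasurable
      (integrable_of_continuous_of_compactSpace hφ _).aestronglyMeasurable]
    rfl

theorem integral_empirical [MeasurableSpace X] {φ : X → E} (hφ : StronglyMeasurable φ)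
    {M : ℕ+} (x : Fin M → X) :
    ∫ y, φ y ∂(empirical x : Measure X) = ((M : ℕ) : ℝ)⁻¹ • ∑ i, φ (x i) := by
  -- Singletons need not be measurable; the set where `φ` equals `φ (x i)` is.
  have h : ∀ i ∈ Finset.univ, Integrable φ (Measure.dirac (x i)) := fun i _ ↦ by
    refine (integrable_const (φ (x i))).congr ?_
    exact (ae_dirac_iff (stronglyMeasurable_const.measurableSet_eq_fun hφ)).2 rfl
  simp only [empirical, ProbabilityMeasure.coe_mk]
  rw [integral_smul_measure, integral_finsetSum_measure h]
  simp [integral_dirac' φ _ hφ]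

/-- Greedy choice of points: if `ψ` has mean zero and norm at most `D`, sums of `n` values of `ψ`
can be kept of norm at most `√n * D`. -/
theorem exists_norm_sum_sq_le [MeasurableSpace X] {μ : Measure X} [IsProbabilityMeasure μ]
    {ψ : X → E} (hψ : Integrable ψ μ) (h0 : ∫ x, ψ x ∂μ = 0) {D : ℝ} (hD : ∀ x, ‖ψ x‖ ≤ D)
    (n : ℕ) : ∃ x : Fin n → X, ‖∑ i, ψ (x i)‖ ^ 2 ≤ n * D ^ 2 := by
  induction n with
  | zero => exact ⟨Fin.elim0, by simp⟩
  | succ n ih =>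
    obtain ⟨x, hx⟩ := ih
    -- The inner product with the current sum has mean zero, so some `y` makes the cross term
    -- nonpositive.
    obtain ⟨y, hy⟩ := exists_le_integral (hψ.const_inner (∑ i, ψ (x i)))
    rw [integral_inner hψ, h0, inner_zero_right] at hy
    refine ⟨Fin.snoc x y, ?_⟩
    simp only [Fin.sum_univ_castSucc, Fin.snoc_castSucc, Fin.snoc_last]
    rw [norm_add_sq_real]
    have := pow_le_pow_left₀ (norm_nonneg _) (hD y) 2
    push_cast
    linarith

/-- Empirical measures of `M` points approximate all barycenters at the rate `1 / √M`. -/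
theorem exists_empirical_norm_sub_le [PseudoMetricSpace X] [CompactSpace X] [MeasurableSpace X]
    [BorelSpace X] {φ : X → E} (hφ : Continuous φ) {C : ℝ} (hC : ∀ x, ‖φ x‖ ≤ C)
    (μ : ProbabilityMeasure X) (M : ℕ+) :
    ∃ x : Fin M → X, ‖∫ y, φ y ∂(empirical x : Measure X) - ∫ y, φ y ∂(μ : Measure X)‖ ≤
      2 * C / √(M : ℕ) := by
  have hint := integrable_of_continuous_of_compactSpace hφ (μ : Measure X)
  set b := ∫ y, φ y ∂(μ : Measure X) with hb
  have hbC : ‖b‖ ≤ C := by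
    simpa using norm_integral_le_of_norm_le_const (μ := (μ : Measure X)) (ae_of_all _ hC)
  obtain ⟨x, hx⟩ := exists_norm_sum_sq_le (μ := (μ : Measure X)) (ψ := fun y ↦ φ y - b)
    (hint.sub (integrable_const b)) (by rw [integral_sub hint (integrable_const b)]; simp [hb])
    (D := 2 * C) (fun y ↦ (norm_sub_le _ _).trans (by linarith [hC y])) M
  have hM : (0 : ℝ) < (M : ℕ) := by exact_mod_cast M.pos
  have hC0 : 0 ≤ C := (norm_nonneg b).trans hbC
  refine ⟨x, ?_⟩
  have heq : ∫ y, φ y ∂(empirical x : Measure X) - b =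
      ((M : ℕ) : ℝ)⁻¹ • ∑ i, (φ (x i) - b) := by
    rw [integral_empirical hφ.stronglyMeasurable, Finset.sum_sub_distrib, smul_sub]
    simp only [Finset.sum_const, Finset.card_univ, Fintype.card_fin, ← Nat.cast_smul_eq_nsmul ℝ]
    rw [inv_smul_smul₀ hM.ne']
  have hs : ‖∑ i, (φ (x i) - b)‖ ≤ √(M : ℕ) * (2 * C) := by
    refine (pow_le_pow_iff_left₀ (norm_nonneg _) (by positivity) two_ne_zero).1 ?_
    rw [mul_pow, Real.sq_sqrt hM.le]
    exact hx
  rw [heq, norm_smul, norm_inv, Real.norm_natCast]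
  calc ((M : ℕ) : ℝ)⁻¹ * ‖∑ i, (φ (x i) - b)‖
      ≤ ((M : ℕ) : ℝ)⁻¹ * (√(M : ℕ) * (2 * C)) := by gcongr
    _ = 2 * C / √(M : ℕ) := by
        nth_rewrite 1 [← Real.mul_self_sqrt hM.le]
        have := (Real.sqrt_pos.2 hM).ne'
        field_simp

end Barycenter

/-! ### Mean embeddings and existence of mean field limits. -/

section Embedding

open Set

variable {X : Type*} [MeasurableSpace X] {Hk : Type*}
  [NormedAddCommGroup Hk] [InnerProductSpace ℝ Hk] [CompleteSpace Hk] [RKHS ℝ Hk X ℝ]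

theorem dist_kme (μ ν : ProbabilityMeasure X) : dist (kme Hk μ) (kme Hk ν) = mmd Hk μ ν :=
  dist_eq_norm _ _

theorem mmd_nonneg (μ ν : ProbabilityMeasure X) : 0 ≤ mmd Hk μ ν := norm_nonneg _

theorem mmd_triangle (μ ν ρ : ProbabilityMeasure X) : mmd Hk μ ρ ≤ mmd Hk μ ν + mmd Hk ν ρ :=
  norm_sub_le_norm_sub_add_norm_sub _ _ _

namespace SpaceAssumption

variable [PseudoMetricSpace X] {k : X → X → ℝ}

theorem continuous_feature (hX : SpaceAssumption Hk k) : Continuous (feature Hk : X → Hk) :=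
  (LipschitzWith.of_dist_le_mul (K := 1) fun x x' ↦ by
    rw [dist_eq_norm, hX.dist_eq, NNReal.coe_one, one_mul]; rfl).continuous

theorem isCompact_range_kme [BorelSpace X] (hX : SpaceAssumption Hk k) :
    IsCompact (range (kme Hk : ProbabilityMeasure X → Hk)) :=
  have := hX.compact
  isCompact_range_integral hX.continuous_feature

/-- Empirical measures are asymptotically dense in the maximum mean discrepancy. -/
theorem exists_approximation_rate [BorelSpace X] (hX : SpaceAssumption Hk k) {N : ℕ → ℕ+}
    (hN : StrictMono N) : ∃ δ : ℕ → ℝ, Tendsto δ atTop (𝓝 0) ∧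
      ∀ (p : ℕ) (μ : ProbabilityMeasure X), ∃ x : Fin (N p) → X,
        mmd Hk (empirical x) μ ≤ δ p := by
  have := hX.compact
  obtain ⟨C, hC⟩ := (isCompact_range hX.continuous_feature).isBounded.exists_norm_le
  refine ⟨fun p ↦ 2 * C / √(N p : ℕ), ?_, fun p μ ↦
    exists_empirical_norm_sub_le hX.continuous_feature (fun x ↦ hC _ (mem_range_self x)) μ (N p)⟩
  have hN' : StrictMono fun p ↦ (N p : ℕ) := fun _ _ h ↦ hN h
  exact Tendsto.const_div_atTop
    (Real.tendsto_sqrt_atTop.comp (tendsto_natCast_atTop_atTop.comp hN'.tendsto_atTop)) _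

/-- Equi-Lipschitz functions of empirical measures have mean field limits along a subsequence. -/
theorem exists_mean_field_limit [BorelSpace X] (hX : SpaceAssumption Hk k) {N : ℕ → ℕ+}
    (hN : StrictMono N) {Y : Type*} [MetricSpace Y] {K : Set Y} (hK : IsCompact K)
    (g : ∀ p, (Fin (N p) → X) → Y) (hgK : ∀ p x, g p x ∈ K) {L : ℝ} (hL : 0 ≤ L)
    (hg : ∀ p x x', dist (g p x) (g p x') ≤ L * mmd Hk (empirical x) (empirical x')) :
    ∃ (m : ℕ → ℕ) (G : ProbabilityMeasure X → Y), StrictMono m ∧ (∀ μ, G μ ∈ K) ∧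
      (∀ μ ν, dist (G μ) (G ν) ≤ L * mmd Hk μ ν) ∧
      ∀ ε > 0, ∀ᶠ j in atTop, ∀ x : Fin (N (m j)) → X,
        dist (g (m j) x) (G (empirical x)) ≤ ε := by
  obtain ⟨δ, hδ, hdense⟩ := hX.exists_approximation_rate hN
  simp only [← dist_kme] at *
  exact exists_uniform_limit hX.isCompact_range_kme.totallyBounded hK
    (fun p (x : Fin (N p) → X) ↦ empirical x) hδ hdense g hgK hL hg

variable {H : Type*} [NormedAddCommGroup H] {U : Set H}

/-- The limit is taken in $H_k$; since the embeddings form a compact set, its values are again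
embeddings of probability measures. -/
theorem exists_limitDynamics [BorelSpace X] (hX : SpaceAssumption Hk k) (hU : IsCompact U)
    {f : ∀ M : ℕ+, (Fin M → X) → U → (Fin M → X)} {Lf : ℝ} (hLf : 0 ≤ Lf)
    (hf : SystemAssumption Hk U f Lf) {N : ℕ → ℕ+} (hN : StrictMono N) :
    ∃ (m : ℕ → ℕ) (F : ProbabilityMeasure X → U → ProbabilityMeasure X), StrictMono m ∧
      IsLimitDynamics Hk U f Lf (N ∘ m) F := by
  obtain ⟨δ, hδ, hdense⟩ := hX.exists_approximation_rate hN
  have htb : TotallyBounded (range fun z : ProbabilityMeasure X × U ↦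
      (WithLp.toLp 2 (kme Hk z.1, (z.2 : H)) : WithLp 2 (Hk × H))) := by
    refine ((hX.isCompact_range_kme.prod hU).image
      (WithLp.prod_continuous_toLp 2 Hk H)).totallyBounded.subset ?_
    rintro _ ⟨z, rfl⟩
    exact ⟨_, ⟨mem_range_self z.1, z.2.2⟩, rfl⟩
  obtain ⟨m, G, hm, hGK, hGL, hG⟩ := exists_uniform_limit htb hX.isCompact_range_kme
    (fun p (a : (Fin (N p) → X) × U) ↦ (empirical a.1, a.2)) hδ
    (fun p z ↦ by
      obtain ⟨x, hx⟩ := hdense p z.1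
      refine ⟨(x, z.2), ?_⟩
      rw [WithLp.prod_dist_eq_of_L2]
      simpa [dist_kme, Real.sqrt_sq (mmd_nonneg _ _)] using hx)
    (fun p a ↦ kme Hk (empirical (f (N p) a.1 a.2))) (fun p a ↦ mem_range_self _) hLf
    (fun p a a' ↦ by
      rw [dist_kme, dist_eq_norm]
      exact hf.lipschitz _ _ _ _ _)
  choose F hF using hGK
  simp only [← hF, dist_kme] at hGL hG
  refine ⟨m, fun μ u ↦ F (μ, u), hm, fun μ ν u u' ↦ ?_, fun ε hε ↦ ?_⟩
  · rw [prodDist, ← dist_eq_norm]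
    exact hGL _ _
  · exact (hG ε hε).mono fun j hj x u ↦ hj (x, u)

/-- The $L^1$ product metric turns the bound $\gamma_k+\|u-u'\|$ into a distance. -/
theorem exists_limitCost [BorelSpace X] (hX : SpaceAssumption Hk k) (hU : IsCompact U)
    {l : ∀ M : ℕ+, (Fin M → X) → U → ℝ} {Ll : ℝ} (hLl : 0 ≤ Ll)
    (hl : CostAssumption Hk U l Ll) {N : ℕ → ℕ+} (hN : StrictMono N) :
    ∃ (m : ℕ → ℕ) (linf : ProbabilityMeasure X → U → ℝ), StrictMono m ∧
      IsLimitCost Hk U l Ll (N ∘ m) linf := by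
  obtain ⟨δ, hδ, hdense⟩ := hX.exists_approximation_rate hN
  obtain ⟨B, hB⟩ := hl.bounded
  have hdist : ∀ z z' : ProbabilityMeasure X × U,
      dist (WithLp.toLp 1 (kme Hk z.1, (z.2 : H)) : WithLp 1 (Hk × H))
        (WithLp.toLp 1 (kme Hk z'.1, (z'.2 : H))) = mmd Hk z.1 z'.1 + ‖(z.2 : H) - z'.2‖ :=
    fun z z' ↦ by rw [WithLp.prod_dist_eq_of_L1, ← dist_kme, ← dist_eq_norm]; rfl
  have htb : TotallyBounded (range fun z : ProbabilityMeasure X × U ↦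
      (WithLp.toLp 1 (kme Hk z.1, (z.2 : H)) : WithLp 1 (Hk × H))) := by
    refine ((hX.isCompact_range_kme.prod hU).image
      (WithLp.prod_continuous_toLp 1 Hk H)).totallyBounded.subset ?_
    rintro _ ⟨z, rfl⟩
    exact ⟨_, ⟨mem_range_self z.1, z.2.2⟩, rfl⟩
  obtain ⟨m, G, hm, -, hGL, hG⟩ := exists_uniform_limit htb (isCompact_Icc (a := -B) (b := B))
    (fun p (a : (Fin (N p) → X) × U) ↦ (empirical a.1, a.2)) hδ
    (fun p z ↦ by
      obtain ⟨x, hx⟩ := hdense p z.1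
      exact ⟨(x, z.2), (hdist _ _).trans_le (by simpa using hx)⟩)
    (fun p a ↦ l (N p) a.1 a.2) (fun p a ↦ abs_le.1 (hB _ _ _)) hLl
    (fun p a a' ↦ by
      rw [hdist]
      exact hl.lipschitz _ _ _ _ _)
  simp only [hdist] at hGL
  exact ⟨m, fun μ u ↦ G (μ, u), hm, fun μ ν u u' ↦ hGL (μ, u) (ν, u'),
    fun ε hε ↦ (hG ε hε).mono fun j hj x u ↦ hj (x, u)⟩

end SpaceAssumption

end Embedding

/-! ### Stability under passing to subsequences. -/

section Subsequence

variable {X : Type*} [MeasurableSpace X] {Hk : Type*}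
  [NormedAddCommGroup Hk] [InnerProductSpace ℝ Hk] [CompleteSpace Hk] [RKHS ℝ Hk X ℝ]
  {H : Type*} [NormedAddCommGroup H] {U : Set H}

theorem IsLimitDynamics.comp {f : ∀ M : ℕ+, (Fin M → X) → U → (Fin M → X)} {Lf : ℝ}
    {N : ℕ → ℕ+} {F : ProbabilityMeasure X → U → ProbabilityMeasure X}
    (hF : IsLimitDynamics Hk U f Lf N F) {m : ℕ → ℕ} (hm : StrictMono m) :
    IsLimitDynamics Hk U f Lf (N ∘ m) F :=
  ⟨hF.lipschitz, fun ε hε ↦ hm.tendsto_atTop.eventually (hF.tendsto ε hε)⟩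

theorem IsLimitCost.comp {l : ∀ M : ℕ+, (Fin M → X) → U → ℝ} {Ll : ℝ}
    {N : ℕ → ℕ+} {linf : ProbabilityMeasure X → U → ℝ}
    (hl : IsLimitCost Hk U l Ll N linf) {m : ℕ → ℕ} (hm : StrictMono m) :
    IsLimitCost Hk U l Ll (N ∘ m) linf :=
  ⟨hl.lipschitz, fun ε hε ↦ hm.tendsto_atTop.eventually (hl.tendsto ε hε)⟩

end Subsequence

/-! ### Passage to the limit in the dynamic programming inequality. -/

section Limit

/-- Evaluation along arbitrary points of a uniform convergence to zero. -/
theorem tendsto_zero_of_eventually_forall_le {A : ℕ → Type*} {r : ∀ p, A p → ℝ}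
    (h0 : ∀ p a, 0 ≤ r p a) (h : ∀ ε > 0, ∀ᶠ p in atTop, ∀ a, r p a ≤ ε) (a : ∀ p, A p) :
    Tendsto (fun p ↦ r p (a p)) atTop (𝓝 0) := by
  rw [Metric.tendsto_nhds]
  intro ε hε
  filter_upwards [h (ε / 2) (by positivity)] with p hp
  rw [Real.dist_0_eq_abs, abs_of_nonneg (h0 _ _)]
  linarith [hp (a p)]

variable {X : Type*} [MeasurableSpace X] {Hk : Type*}
  [NormedAddCommGroup Hk] [InnerProductSpace ℝ Hk] [CompleteSpace Hk] [RKHS ℝ Hk X ℝ]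
  {H : Type*} [NormedAddCommGroup H] {U : Set H} {k : X → X → ℝ}

/-- A mean field limit which is Lipschitz is also the limit of the values along points whose
empirical measures converge. -/
theorem tendsto_of_mean_field_limit {Y : Type*} [PseudoMetricSpace Y] {N : ℕ → ℕ+}
    {g : ∀ p, (Fin (N p) → X) → Y} {G : ProbabilityMeasure X → Y} {L : ℝ}
    (hGL : ∀ μ ν, dist (G μ) (G ν) ≤ L * mmd Hk μ ν)
    (hG : ∀ ε > 0, ∀ᶠ p in atTop, ∀ x : Fin (N p) → X, dist (g p x) (G (empirical x)) ≤ ε)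
    {x : ∀ p, Fin (N p) → X} {μ : ProbabilityMeasure X}
    (hx : Tendsto (fun p ↦ mmd Hk (empirical (x p)) μ) atTop (𝓝 0)) :
    Tendsto (fun p ↦ g p (x p)) atTop (𝓝 (G μ)) := by
  rw [tendsto_iff_dist_tendsto_zero]
  have h1 := tendsto_zero_of_eventually_forall_le (fun _ _ ↦ dist_nonneg) hG x
  refine squeeze_zero (fun _ ↦ dist_nonneg)
    (fun p ↦ (dist_triangle _ (G (empirical (x p))) _).trans (add_le_add_right (hGL _ _) _)) ?_
  simpa using h1.add (hx.const_mul L)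

theorem tendsto_prodDist {μ : ℕ → ProbabilityMeasure X} {ν : ProbabilityMeasure X} {u : ℕ → H}
    {w : H} (hμ : Tendsto (fun p ↦ mmd Hk (μ p) ν) atTop (𝓝 0)) (hu : Tendsto u atTop (𝓝 w)) :
    Tendsto (fun p ↦ prodDist Hk (μ p) ν (u p) w) atTop (𝓝 0) := by
  have h : ∀ p, prodDist Hk (μ p) ν (u p) w = √(mmd Hk (μ p) ν ^ 2 + ‖u p - w‖ ^ 2) := fun p ↦ by
    rw [prodDist, WithLp.prod_norm_eq_of_L2]; rfl
  simp only [h]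
  simpa using ((hμ.pow 2).add ((tendsto_iff_norm_sub_tendsto_zero.1 hu).pow 2)).sqrt

/-- The relaxed dynamic programming inequality passes to mean field limits. -/
theorem relaxed_dynamic_programming_limit [PseudoMetricSpace X] [BorelSpace X] (hX : SpaceAssumption Hk k)
    {f : ∀ M : ℕ+, (Fin M → X) → U → (Fin M → X)} {Lf : ℝ}
    {l : ∀ M : ℕ+, (Fin M → X) → U → ℝ} {Ll : ℝ} {N : ℕ → ℕ+} (hN : StrictMono N)
    {F : ProbabilityMeasure X → U → ProbabilityMeasure X}
    {linf : ProbabilityMeasure X → U → ℝ} (hF : IsLimitDynamics Hk U f Lf N F)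
    (hlinf : IsLimitCost Hk U l Ll N linf)
    {W : ∀ p, (Fin (N p) → X) → ℝ} {Winf : ProbabilityMeasure X → ℝ} {LV : ℝ}
    (hWL : ∀ μ ν, dist (Winf μ) (Winf ν) ≤ LV * mmd Hk μ ν)
    (hW : ∀ ε > 0, ∀ᶠ p in atTop, ∀ x : Fin (N p) → X, dist (W p x) (Winf (empirical x)) ≤ ε)
    {κ : ∀ p, (Fin (N p) → X) → U} {κinf : ProbabilityMeasure X → U} {Lκ : ℝ}
    (hκL : ∀ μ ν, dist (κinf μ) (κinf ν) ≤ Lκ * mmd Hk μ ν)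
    (hκ : ∀ ε > 0, ∀ᶠ p in atTop, ∀ x : Fin (N p) → X, dist (κ p x) (κinf (empirical x)) ≤ ε)
    {α : ℝ} (hdp : ∀ p x, W p x ≥ W p (f (N p) x (κ p x)) + α * l (N p) x (κ p x))
    (μ : ProbabilityMeasure X) :
    Winf μ ≥ Winf (F μ (κinf μ)) + α * linf μ (κinf μ) := by
  obtain ⟨δ, hδ, hdense⟩ := hX.exists_approximation_rate hN
  choose x hx using fun p ↦ hdense p μ
  have hx0 : Tendsto (fun p ↦ mmd Hk (empirical (x p)) μ) atTop (𝓝 0) :=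
    squeeze_zero (fun _ ↦ mmd_nonneg _ _) hx hδ
  have hκx : Tendsto (fun p ↦ κ p (x p)) atTop (𝓝 (κinf μ)) :=
    tendsto_of_mean_field_limit hκL hκ hx0
  have hκx' : Tendsto (fun p ↦ (κ p (x p) : H)) atTop (𝓝 (κinf μ)) :=
    (continuous_subtype_val.tendsto _).comp hκx
  -- The successors' empirical measures converge too, so the limit of `W` can be evaluated along
  -- them.
  have hy0 : Tendsto (fun p ↦ mmd Hk (empirical (f (N p) (x p) (κ p (x p)))) (F μ (κinf μ)))
      atTop (𝓝 0) := by
    have h1 := tendsto_zero_of_eventually_forall_le (A := fun p ↦ (Fin (N p) → X) × U)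
      (r := fun p a ↦ mmd Hk (empirical (f (N p) a.1 a.2)) (F (empirical a.1) a.2))
      (fun _ _ ↦ mmd_nonneg _ _)
      (fun ε hε ↦ (hF.tendsto ε hε).mono fun p hp a ↦ hp a.1 a.2)
      (fun p ↦ (x p, κ p (x p)))
    refine squeeze_zero (fun _ ↦ mmd_nonneg _ _)
      (fun p ↦ (mmd_triangle _ (F (empirical (x p)) (κ p (x p))) _).trans
        (add_le_add_right (hF.lipschitz _ _ _ _) _)) ?_
    simpa using h1.add ((tendsto_prodDist hx0 hκx').const_mul Lf)
  have hl0 : Tendsto (fun p ↦ l (N p) (x p) (κ p (x p))) atTop (𝓝 (linf μ (κinf μ))) := by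
    have h1 := tendsto_zero_of_eventually_forall_le (A := fun p ↦ (Fin (N p) → X) × U)
      (r := fun p a ↦ |l (N p) a.1 a.2 - linf (empirical a.1) a.2|)
      (fun _ _ ↦ abs_nonneg _)
      (fun ε hε ↦ (hlinf.tendsto ε hε).mono fun p hp a ↦ hp a.1 a.2)
      (fun p ↦ (x p, κ p (x p)))
    rw [tendsto_iff_dist_tendsto_zero]
    refine squeeze_zero (fun _ ↦ dist_nonneg)
      (fun p ↦ (dist_triangle _ (linf (empirical (x p)) (κ p (x p))) _).trans
        (add_le_add_right (hlinf.lipschitz _ _ _ _) _)) ?_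
    simpa [Real.dist_eq] using
      h1.add ((hx0.add (tendsto_iff_norm_sub_tendsto_zero.1 hκx')).const_mul Ll)
  exact le_of_tendsto_of_tendsto'
    ((tendsto_of_mean_field_limit hWL hW hy0).add (hl0.const_mul α))
    (tendsto_of_mean_field_limit hWL hW hx0) fun p ↦ hdp p (x p)

/-- After subtraction of suitable constants, which vanish in the bounded case, nonnegative
equi-Lipschitz functions take values in a fixed compact interval. -/
theorem exists_sub_const_mem_Icc [Nonempty X] [PseudoMetricSpace X] [BorelSpace X] (hX : SpaceAssumption Hk k)
    {N : ℕ → ℕ+} {V : ∀ p, (Fin (N p) → X) → ℝ} (hV0 : ∀ p x, 0 ≤ V p x) {LV : ℝ} (hLV : 0 ≤ LV)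
    (hV : ∀ p x x', |V p x - V p x'| ≤ LV * mmd Hk (empirical x) (empirical x')) :
    ∃ (c : ℕ → ℝ) (B : ℝ), (∀ p x, V p x - c p ∈ Set.Icc 0 B) ∧
      ((∃ B, ∀ p x, V p x ≤ B) → c = 0) := by
  by_cases hb : ∃ B, ∀ p x, V p x ≤ B
  · obtain ⟨B, hB⟩ := hb
    exact ⟨0, B, fun p x ↦ by simpa using ⟨hV0 p x, hB p x⟩, fun _ ↦ rfl⟩
  obtain ⟨D, hD⟩ := hX.isCompact_range_kme.isBounded.exists_norm_le
  have hbdd : ∀ p, BddBelow (Set.range (V p)) := fun p ↦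
    ⟨0, by rintro _ ⟨x, rfl⟩; exact hV0 p x⟩
  -- The embeddings have norm at most `D`, so each `V p` oscillates by at most `LV * (D + D)`.
  refine ⟨fun p ↦ ⨅ x, V p x, LV * (D + D), fun p x ↦ ⟨?_, ?_⟩, fun h ↦ absurd h hb⟩
  · exact sub_nonneg.2 (ciInf_le (hbdd p) x)
  · rw [sub_le_comm]
    refine le_ciInf fun x' ↦ ?_
    have h1 : mmd Hk (empirical x) (empirical x') ≤ D + D :=
      (norm_sub_le _ _).trans (add_le_add (hD _ ⟨_, rfl⟩) (hD _ ⟨_, rfl⟩))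
    linarith [(abs_le.1 (hV p x x')).2, mul_le_mul_of_nonneg_left h1 hLV]

end Limit

end MeanField

/-! ### Assembly of the limits. -/

theorem theorem3 {X : Type*} [Nonempty X] [PseudoMetricSpace X] [MeasurableSpace X] [BorelSpace X]
    {Hk : Type*} [NormedAddCommGroup Hk] [InnerProductSpace ℝ Hk] [CompleteSpace Hk]
    [RKHS ℝ Hk X ℝ]
    {H : Type*} [NormedAddCommGroup H] [InnerProductSpace ℝ H] [CompleteSpace H]
    (k : X → X → ℝ) (hX : MeanField.SpaceAssumption Hk k)
    (U : Set H) (hUcompact : IsCompact U) (hUconvex : Convex ℝ U)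
    (f : ∀ M : ℕ+, (Fin M → X) → U → (Fin M → X)) (Lf : ℝ) (hLf : 0 ≤ Lf)
    (hf : MeanField.SystemAssumption Hk U f Lf)
    (l : ∀ M : ℕ+, (Fin M → X) → U → ℝ) (Ll : ℝ) (hLl : 0 ≤ Ll)
    (hl : MeanField.CostAssumption Hk U l Ll) :
    -- the mean field limits of the dynamics and of the stage cost exist along a subsequence
    (∃ (N : ℕ → ℕ+) (F : ProbabilityMeasure X → U → ProbabilityMeasure X)
      (linf : ProbabilityMeasure X → U → ℝ), StrictMono N ∧
        MeanField.IsLimitDynamics Hk U f Lf N F ∧ MeanField.IsLimitCost Hk U l Ll N linf) ∧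
    -- relaxed dynamic programming passes to the limit, for any such limits
    ∀ (N : ℕ → ℕ+) (F : ProbabilityMeasure X → U → ProbabilityMeasure X)
      (linf : ProbabilityMeasure X → U → ℝ), StrictMono N →
      MeanField.IsLimitDynamics Hk U f Lf N F → MeanField.IsLimitCost Hk U l Ll N linf →
    ∀ (V : ∀ M : ℕ+, (Fin M → X) → ℝ≥0) (LV : ℝ), 0 ≤ LV →
      (∀ (p : ℕ) (x : Fin (N p) → X) (σ : Equiv.Perm (Fin (N p))),
        V (N p) (x ∘ σ) = V (N p) x) →
      (∀ (p : ℕ) (x x' : Fin (N p) → X),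
        |(V (N p) x : ℝ) - V (N p) x'| ≤
          LV * MeanField.mmd Hk (MeanField.empirical x) (MeanField.empirical x')) →
    ∀ (κ : ∀ M : ℕ+, (Fin M → X) → U) (Lκ : ℝ), 0 ≤ Lκ →
      (∀ (p : ℕ) (x : Fin (N p) → X) (σ : Equiv.Perm (Fin (N p))),
        κ (N p) (x ∘ σ) = κ (N p) x) →
      (∀ (p : ℕ) (x x' : Fin (N p) → X),
        ‖(κ (N p) x : H) - κ (N p) x'‖ ≤
          Lκ * MeanField.mmd Hk (MeanField.empirical x) (MeanField.empirical x')) →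
    ∀ α : ℝ, 0 < α → α ≤ 1 →
      (∀ (p : ℕ) (x : Fin (N p) → X),
        (V (N p) x : ℝ) ≥
          V (N p) (f (N p) x (κ (N p) x)) + α * l (N p) x (κ (N p) x)) →
    ∃ (m : ℕ → ℕ) (Vinf : ProbabilityMeasure X → ℝ≥0) (κinf : ProbabilityMeasure X → U),
      StrictMono m ∧
      (∀ μ ν : ProbabilityMeasure X, |(Vinf μ : ℝ) - Vinf ν| ≤ LV * MeanField.mmd Hk μ ν) ∧
      (∀ μ ν : ProbabilityMeasure X,
        ‖(κinf μ : H) - κinf ν‖ ≤ Lκ * MeanField.mmd Hk μ ν) ∧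
      -- `κinf` is the mean field limit of the feedbacks along the subsequence `N ∘ m`
      (∀ ε > 0, ∀ᶠ j in atTop, ∀ x : Fin (N (m j)) → X,
        ‖(κ (N (m j)) x : H) - κinf (MeanField.empirical x)‖ ≤ ε) ∧
      -- if the value functions are uniformly bounded, `Vinf` is their mean field limit
      ((∃ B : ℝ, ∀ (p : ℕ) (x : Fin (N p) → X), (V (N p) x : ℝ) ≤ B) →
        ∀ ε > 0, ∀ᶠ j in atTop, ∀ x : Fin (N (m j)) → X,
          |(V (N (m j)) x : ℝ) - Vinf (MeanField.empirical x)| ≤ ε) ∧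
      (∀ μ : ProbabilityMeasure X,
        (Vinf μ : ℝ) ≥ Vinf (F μ (κinf μ)) + α * linf μ (κinf μ)) := by
  refine ⟨?_, fun N F linf hN hF hlinf V LV hLV _ hV κ Lκ hLκ _ hκ α _ _ hdp ↦ ?_⟩
  · have hN : StrictMono Nat.succPNat := Nat.succPNat_strictMono
    obtain ⟨m, F, hm, hF⟩ := hX.exists_limitDynamics hUcompact hLf hf hN
    obtain ⟨n, linf, hn, hlinf⟩ := hX.exists_limitCost hUcompact hLl hl (hN.comp hm)
    exact ⟨_, F, linf, (hN.comp hm).comp hn, hF.comp hn, hlinf⟩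
  have : CompactSpace U := isCompact_iff_compactSpace.1 hUcompact
  obtain ⟨m, κinf, hm, -, hκL, hκlim⟩ := hX.exists_mean_field_limit hN (isCompact_univ (X := U))
    (fun p x ↦ κ (N p) x) (fun _ _ ↦ Set.mem_univ _) hLκ
    (fun p x x' ↦ by rw [Subtype.dist_eq, dist_eq_norm]; exact hκ p x x')
  -- As `c = 0` in the bounded case, one extraction serves both claims about `Vinf`; the lower
  -- endpoint `0` makes the limit nonnegative.
  obtain ⟨c, B, hcB, hc⟩ := MeanField.exists_sub_const_mem_Icc hX
    (V := fun p (x : Fin (N p) → X) ↦ (V (N p) x : ℝ)) (fun _ _ ↦ NNReal.coe_nonneg _) hLV hV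
  obtain ⟨n, Winf, hn, hW0, hWL, hWlim⟩ := hX.exists_mean_field_limit (hN.comp hm)
    (isCompact_Icc (a := (0 : ℝ)) (b := B)) (fun p x ↦ (V (N (m p)) x : ℝ) - c (m p))
    (fun p x ↦ hcB _ x) hLV
    (fun p x x' ↦ by simpa [Real.dist_eq] using hV (m p) x x')
  have hκlim' : ∀ ε > 0, ∀ᶠ j in atTop, ∀ x : Fin (N (m (n j))) → X,
      dist (κ (N (m (n j))) x) (κinf (MeanField.empirical x)) ≤ ε :=
    fun ε hε ↦ hn.tendsto_atTop.eventually (hκlim ε hε)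
  refine ⟨m ∘ n, fun μ ↦ ⟨Winf μ, (hW0 μ).1⟩, κinf, hm.comp hn, hWL, fun μ ν ↦ ?_,
    fun ε hε ↦ ?_, fun hb ε hε ↦ ?_, fun μ ↦ ?_⟩
  · rw [← dist_eq_norm, ← Subtype.dist_eq]
    exact hκL μ ν
  · filter_upwards [hκlim' ε hε] with j hj x
    rw [← dist_eq_norm, ← Subtype.dist_eq]
    exact hj x
  · filter_upwards [hWlim ε hε] with j hj x
    have := hj x
    simp only [hc hb, Pi.zero_apply, sub_zero, Real.dist_eq] at this
    exact this
  -- The same constant is subtracted on both sides of the inequality, so it cancels.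
  · refine MeanField.relaxed_dynamic_programming_limit hX ((hN.comp hm).comp hn)
      ((hF.comp hm).comp hn) ((hlinf.comp hm).comp hn) hWL hWlim hκL hκlim' (fun p x ↦ ?_) μ
    have := hdp (m (n p)) x
    simp only [Function.comp_apply]
    linarith
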